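/- Let $\mathbb{K}$ be $\mathbb{R}$ or $\mathbb{C}$, let $\mathfrak{g} \neq 0$ be a finite-dimensional Lie algebra over $\mathbb{K}$ with its unique Hausdorff vector space topology, and let $R \geq 1$ be a real number. For a continuous seminorm $p$ on $\mathfrak{g}$ let $p^n = p^{\otimes n}$ be its projective tensor power on $\mathfrak{g}^{\otimes n}$ ($p^0$ is the absolute value on $\mathbb{K}$), and let $p_R = \sum_{n=0}^{\infty} n!^R\, p^n$ on the tensor algebra $\mathrm{T}^\bullet(\mathfrak{g})$. The seminorms $p_R$, for all continuous seminorms $p$, define a locally convex topology on $\mathrm{T}^\bullet(\mathfrak{g})$. The topology it induces on the subspace $\mathrm{S}^\bullet(\mathfrak{g}) \subseteq \mathrm{T}^\bullet(\mathfrak{g})$ of symmetric tensors, transported to the universal enveloping algebra $\mathcal{U}(\mathfrak{g})$ along the Poincaré–Birkhoff–Witt isomorphism $$\mathfrak{q} \colon \mathrm{S}^\bullet(\mathfrak{g}) \to \mathcal{U}(\mathfrak{g}), \qquad \xi_1 \cdots \xi_n \mapsto \frac{1}{n!} \sum_{\sigma \in S_n} \xi_{\sigma(1)} \odot \cdots \odot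 \xi_{\sigma(n)},$$ where $\odot$ denotes the product of $\mathcal{U}(\mathfrak{g})$, is called the $\mathrm{S}_R$-topology on $\mathcal{U}(\mathfrak{g})$. Then there is a coarsest locally convex topology $\tau$ on $\mathcal{U}(\mathfrak{g})$ for which the extension $\mathcal{U}(\mathfrak{g}) \to \mathrm{End}(V)$ of every finite-dimensional representation $V$ of $\mathfrak{g}$ over $\mathbb{K}$ is continuous ($\mathrm{End}(V)$ with its usual topology), and the $\mathrm{S}_R$-topology on $\mathcal{U}(\mathfrak{g})$ is strictly finer than $\tau$. -/

import Mathlib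

open scoped TensorProduct DirectSum Nat

universe u v w

noncomputable section

section SymTopology

variable (K : Type*) [RCLike K] {V : Type*} [AddCommGroup V] [Module K V]

/-- The `n`-th projective tensor power `p ^ n = p ⊗ ⋯ ⊗ p` of a seminorm `p` on `V`: the infimum
of `∑ⱼ |cⱼ| ∏ᵢ p (v i j)` over all ways of writing a tensor as `∑ⱼ cⱼ • (v 1 j ⊗ ⋯ ⊗ v n j)`. For
`n = 0` it is the absolute value on `K`. -/
def piSeminorm (p : Seminorm K V) (n : ℕ) : Seminorm K (⨂[K]^n V) :=
  letI : SeminormedAddCommGroup V := p.toAddGroupSeminorm.toSeminormedAddCommGroup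
  letI : NormedSpace K V := ⟨fun a b => (map_smul_eq_mul p a b).le⟩
  PiTensorProduct.projectiveSeminorm (𝕜 := K) (E := fun _ : Fin n => V)

theorem piSeminorm_apply (p : Seminorm K V) (n : ℕ) (x : ⨂[K]^n V) :
    piSeminorm K p n x =
      ⨅ l : PiTensorProduct.lifts x,
        (l.1.toList.map fun a : K × (Fin n → V) => ‖a.1‖ * ∏ i, p (a.2 i)).sum :=
  rfl

/-- The homogeneous component of degree `n` of an element of the tensor algebra. -/
def tensorComponent (V : Type*) [AddCommGroup V] [Module K V] (n : ℕ) :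
    TensorAlgebra K V →ₗ[K] ⨂[K]^n V :=
  DirectSum.component K ℕ (fun n => ⨂[K]^n V) n ∘ₗ TensorAlgebra.toDirectSum.toLinearMap

variable {K} in
theorem finite_support_tensorComponent (x : TensorAlgebra K V) :
    {n | tensorComponent K V n x ≠ 0}.Finite := by
  classical
  refine (DFinsupp.finite_support (TensorAlgebra.toDirectSum x)).subset ?_
  intro n hn
  exact hn

variable {K} in
theorem summable_tensorSeminorm (R : ℝ) (p : Seminorm K V) (x : TensorAlgebra K V) :
    Summable fun n : ℕ => (n ! : ℝ) ^ R * piSeminorm K p n (tensorComponent K V n x) := by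
  refine summable_of_hasFiniteSupport ((finite_support_tensorComponent x).subset ?_)
  intro n hn h
  apply hn
  simp [h]

/-- The seminorm `p_R = ∑ₙ n! ^ R • p ^ n` on the tensor algebra (a finite sum at each element). -/
def tensorSeminorm (R : ℝ) (p : Seminorm K V) : Seminorm K (TensorAlgebra K V) :=
  Seminorm.of
    (fun x => ∑' n : ℕ, (n ! : ℝ) ^ R * piSeminorm K p n (tensorComponent K V n x))
    (fun x y => by
      rw [← (summable_tensorSeminorm R p x).tsum_add (summable_tensorSeminorm R p y)]
      refine (summable_tensorSeminorm R p (x + y)).tsum_le_tsum (fun n => ?_)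
        ((summable_tensorSeminorm R p x).add (summable_tensorSeminorm R p y))
      rw [map_add, ← mul_add]
      gcongr
      exact map_add_le_add _ _ _)
    (fun a x => by
      rw [← tsum_mul_left]
      refine tsum_congr fun n => ?_
      rw [map_smul, map_smul_eq_mul]
      ring)

variable (V) in
/-- The `T_R`-topology on the tensor algebra of a topological vector space `V`: the locally convex
topology defined by the seminorms `p_R`, for all continuous seminorms `p` on `V`. -/
@[reducible] def tensorTopology [TopologicalSpace V] (R : ℝ) : TopologicalSpace (TensorAlgebra K V) :=
  ⨅ p : {p : Seminorm K V // Continuous p},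
    (tensorSeminorm K R p.1).toAddGroupSeminorm.toSeminormedAddCommGroup.toUniformSpace.toTopologicalSpace

/-- The symmetrization map `v 1 ⊗ ⋯ ⊗ v n ↦ (1 / n!) ∑ σ, v (σ 1) ⊗ ⋯ ⊗ v (σ n)`. -/
def symmetrizer (V : Type*) [AddCommGroup V] [Module K V] (n : ℕ) : ⨂[K]^n V →ₗ[K] ⨂[K]^n V :=
  (n ! : K)⁻¹ • ∑ σ : Equiv.Perm (Fin n),
    (PiTensorProduct.reindex K (fun _ : Fin n => V) σ).toLinearMap

theorem symmetrizer_tprod (n : ℕ) (v : Fin n → V) :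
    symmetrizer K V n (PiTensorProduct.tprod K v) =
      (n ! : K)⁻¹ • ∑ σ : Equiv.Perm (Fin n), PiTensorProduct.tprod K (v ∘ σ) := by
  simp only [symmetrizer, LinearMap.smul_apply, LinearMap.sum_apply, LinearEquiv.coe_coe]
  congr 1
  rw [← Equiv.sum_comp (Equiv.inv (Equiv.Perm (Fin n)))]
  refine Finset.sum_congr rfl fun σ _ => ?_
  exact PiTensorProduct.reindex_tprod _ _

variable (V) in
/-- The symmetric algebra of `V`, viewed as the subspace of those elements of the tensor algebra
all of whose homogeneous components are symmetric tensors. -/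
def symmetricTensors : Submodule K (TensorAlgebra K V) :=
  ⨅ n : ℕ, (LinearMap.range (symmetrizer K V n)).comap (tensorComponent K V n)

variable (V) in
/-- The `Sym_R`-topology on the symmetric algebra: the topology induced by the `T_R`-topology. -/
@[reducible] def symTopology [TopologicalSpace V] (R : ℝ) : TopologicalSpace (symmetricTensors K V) :=
  (tensorTopology K V R).induced Subtype.val

end SymTopology

section EnvelopingAlgebra

variable (K : Type u) [RCLike K] (g : Type v) [LieRing g] [LieAlgebra K g]

/-- The Poincaré-Birkhoff-Witt isomorphism
`ξ 1 ⋯ ξ n ↦ (1 / n!) ∑ σ, ξ (σ 1) ⊙ ⋯ ⊙ ξ (σ n)` from the symmetric algebra onto the universal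
enveloping algebra, i.e. the restriction to the symmetric tensors of the canonical homomorphism
from the tensor algebra. -/
def pbwMap : symmetricTensors K g →ₗ[K] UniversalEnvelopingAlgebra K g :=
  (TensorAlgebra.lift K (UniversalEnvelopingAlgebra.ι K (L := g) : g →ₗ[K] _)).toLinearMap ∘ₗ (symmetricTensors K g).subtype

variable {K g} in
theorem pbwMap_symmetrizer_tprod (n : ℕ) (v : Fin n → g) (x : symmetricTensors K g)
    (hx : TensorAlgebra.toDirectSum (x : TensorAlgebra K g) =
      DirectSum.lof K ℕ (fun n => ⨂[K]^n g) n
        (symmetrizer K g n (PiTensorProduct.tprod K v))) :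
    pbwMap K g x = (n ! : K)⁻¹ • ∑ σ : Equiv.Perm (Fin n),
      (List.ofFn fun i => UniversalEnvelopingAlgebra.ι K (v (σ i))).prod := by
  have h : (x : TensorAlgebra K g) = (n ! : K)⁻¹ • ∑ σ : Equiv.Perm (Fin n),
      TensorAlgebra.tprod K g n (v ∘ σ) := by
    rw [← TensorAlgebra.ofDirectSum_toDirectSum (x : TensorAlgebra K g), hx, symmetrizer_tprod,
      map_smul, map_smul, map_sum, map_sum]
    congr 1
    refine Finset.sum_congr rfl fun σ _ => ?_
    exact TensorAlgebra.ofDirectSum_of_tprod _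
  simp [pbwMap, h, TensorAlgebra.tprod_apply, map_list_prod, List.map_ofFn, Function.comp_def]

/-- The `Sym_R`-topology on the universal enveloping algebra: the `Sym_R`-topology of the symmetric
algebra, transported along the Poincaré-Birkhoff-Witt isomorphism `pbwMap` (a set is open when its
preimage is). -/
@[reducible] def envelopingSymTopology [TopologicalSpace g] (R : ℝ) :
    TopologicalSpace (UniversalEnvelopingAlgebra K g) :=
  (symTopology K g R).coinduced (pbwMap K g)

/-- A topology `t` on the universal enveloping algebra for which the extension `U(g) → End V` of
every finite-dimensional representation `V` of `g` is continuous. Here `End V` carries its module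
topology, which is the usual topology of a finite-dimensional vector space. -/
def FiniteDimRepsContinuous (t : TopologicalSpace (UniversalEnvelopingAlgebra K g)) : Prop :=
  ∀ (V : Type w) [AddCommGroup V] [Module K V] [FiniteDimensional K V]
    [LieRingModule g V] [LieModule K g V],
    @Continuous _ _ t (moduleTopology K (Module.End K V))
      (UniversalEnvelopingAlgebra.lift K (LieModule.toEnd K g V))

/-- A topology `t` on a `K`-vector space is locally convex if it is defined by a family of
seminorms. -/
def IsLocallyConvexTopology (E : Type*) [AddCommGroup E] [Module K E] (t : TopologicalSpace E) :
    Prop :=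
  @PolynormableSpace K E _ _ _ t

end EnvelopingAlgebra

end

/-! The topology `τ` is the weak topology of all coefficients of finite-dimensional representations.
A coefficient has exponential growth: on a word of length `n` it is at most `C * M ^ n * ∏ p (v i)`.
Since `M ^ n ≤ exp M * n !`, it is dominated by a multiple of `p_R` as soon as `R ≥ 1`, so the
`S_R`-topology is finer than `τ`.

It is strictly finer because weak topologies only see finitely many functionals at a time. Tensor
powers of one nontrivial representation give infinitely many independent coefficients `f k`
(`exists_triangular_coefficients`). Rescaled by `c k > 0`, all obey the same `p_R` bound, so
together they form an `S_R`-continuous map `Φ` into `ℓ^∞`. If `Φ` were continuous for `τ`, finitely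
many functionals would control it (`exists_finite_iInf_ker_le_of_continuous_iInf_induced`), and
every `f k` would lie in their finite-dimensional span. -/

/-! ### Growth of functionals and continuity for the `S_R`-topology -/

section Functionals

variable {K : Type*} [RCLike K]

/-- The `ℓ¹`-seminorm of the coordinates with respect to a basis of a finite-dimensional space. -/
noncomputable def coordSeminorm (K : Type*) [RCLike K] (W : Type*) [AddCommGroup W] [Module K W]
    [FiniteDimensional K W] : Seminorm K W :=
  Seminorm.of (fun x => ∑ i, ‖(Module.finBasis K W).repr x i‖)
    (fun x y => by
      rw [← Finset.sum_add_distrib]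
      exact Finset.sum_le_sum fun i _ => by simpa using norm_add_le _ _)
    (fun a x => by simp [Finset.mul_sum])

theorem coordSeminorm_apply {W : Type*} [AddCommGroup W] [Module K W] [FiniteDimensional K W]
    (x : W) : coordSeminorm K W x = ∑ i, ‖(Module.finBasis K W).repr x i‖ :=
  rfl

theorem exists_seminorm_le_coordSeminorm {W W' : Type*} [AddCommGroup W] [Module K W]
    [FiniteDimensional K W] [AddCommGroup W'] [Module K W'] (N : Seminorm K W') (T : W →ₗ[K] W') :
    ∃ M, 0 ≤ M ∧ ∀ x, N (T x) ≤ M * coordSeminorm K W x := by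
  set b := Module.finBasis K W with hb
  refine ⟨∑ i, N (T (b i)), Finset.sum_nonneg fun i _ => apply_nonneg _ _, fun x => ?_⟩
  have hsum : ∀ s : Finset (Fin (Module.finrank K W)),
      N (∑ i ∈ s, b.repr x i • T (b i)) ≤ ∑ i ∈ s, ‖b.repr x i‖ * N (T (b i)) := by
    intro s
    refine (Finset.le_sum_of_subadditive N (map_zero N).le (map_add_le_add N) _ _).trans_eq ?_
    exact Finset.sum_congr rfl fun i _ => map_smul_eq_mul N _ _
  conv_lhs => rw [← b.sum_repr x, map_sum]
  simp only [map_smul]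
  refine (hsum _).trans ?_
  rw [coordSeminorm_apply, Finset.mul_sum]
  refine Finset.sum_le_sum fun i _ => ?_
  rw [mul_comm]
  gcongr
  exact Finset.single_le_sum (f := fun i => N (T (b i))) (fun i _ => apply_nonneg _ _)
    (Finset.mem_univ i)

theorem continuous_coordSeminorm {W : Type*} [AddCommGroup W] [Module K W]
    [FiniteDimensional K W] [TopologicalSpace W] [IsTopologicalAddGroup W] [ContinuousSMul K W]
    [T2Space W] : Continuous (coordSeminorm K W) := by
  have h : (coordSeminorm K W : W → ℝ) = fun x => ∑ i, ‖(Module.finBasis K W).coord i x‖ := by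
    ext x
    simp [coordSeminorm_apply]
  rw [h]
  exact continuous_finsetSum _ fun i _ =>
    (LinearMap.continuous_of_finiteDimensional ((Module.finBasis K W).coord i)).norm

theorem exists_coordSeminorm_mul_le (A : Type*) [Ring A] [Algebra K A] [FiniteDimensional K A] :
    ∃ C, 0 ≤ C ∧ ∀ a b : A,
      coordSeminorm K A (a * b) ≤ C * (coordSeminorm K A a * coordSeminorm K A b) := by
  set N := coordSeminorm K A
  choose M hM0 hM using fun i => exists_seminorm_le_coordSeminorm N
    (LinearMap.mulLeft K (Module.finBasis K A i))
  refine ⟨∑ i, M i, Finset.sum_nonneg fun i _ => hM0 i, fun a b => ?_⟩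
  conv_lhs => rw [← (Module.finBasis K A).sum_repr a, Finset.sum_mul]
  refine (Finset.le_sum_of_subadditive N (map_zero N).le (map_add_le_add N) _ _).trans ?_
  rw [← mul_assoc, mul_comm _ (N a)]
  show _ ≤ coordSeminorm K A a * _ * _
  rw [coordSeminorm_apply a, Finset.sum_mul, Finset.sum_mul]
  refine Finset.sum_le_sum fun i _ => ?_
  rw [smul_mul_assoc, map_smul_eq_mul, mul_assoc]
  gcongr
  refine (hM i b).trans ?_
  gcongr
  exact Finset.single_le_sum (f := M) (fun i _ => hM0 i) (Finset.mem_univ i)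

/-- Coefficients of finite-dimensional representations have exponential growth. -/
theorem exists_norm_functional_prod_le {g A : Type*} [AddCommGroup g] [Module K g]
    [FiniteDimensional K g] [Ring A] [Algebra K A] [FiniteDimensional K A]
    (θ : g →ₗ[K] A) (l : A →ₗ[K] K) :
    ∃ C M, 0 ≤ C ∧ 0 ≤ M ∧ ∀ (n : ℕ) (v : Fin n → g),
      ‖l (List.ofFn fun i => θ (v i)).prod‖ ≤ C * (M ^ n * ∏ i, coordSeminorm K g (v i)) := by
  obtain ⟨L, hL0, hL⟩ := exists_seminorm_le_coordSeminorm (normSeminorm K K) l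
  obtain ⟨B, hB0, hB⟩ := exists_seminorm_le_coordSeminorm (coordSeminorm K A) θ
  obtain ⟨D, hD0, hD⟩ := exists_coordSeminorm_mul_le (K := K) A
  have key : ∀ (n : ℕ) (v : Fin n → g), coordSeminorm K A (List.ofFn fun i => θ (v i)).prod ≤
      coordSeminorm K A 1 * ((D * B) ^ n * ∏ i, coordSeminorm K g (v i)) := by
    intro n
    induction n with
    | zero => intro v; simp
    | succ n ih =>
      intro v
      rw [List.ofFn_succ, List.prod_cons, Fin.prod_univ_succ]
      calc _ ≤ D * ((B * coordSeminorm K g (v 0)) * (coordSeminorm K A 1 *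
            ((D * B) ^ n * ∏ i : Fin n, coordSeminorm K g (v i.succ)))) := by
            refine (hD _ _).trans ?_
            gcongr
            · exact hB _
            · exact ih _
        _ = _ := by ring
  refine ⟨L * coordSeminorm K A 1, D * B, by positivity, by positivity, fun n v => ?_⟩
  refine (hL _).trans ?_
  rw [mul_assoc]
  gcongr
  exact key n v

/-- One term of the exponential series is at most its sum. This is where `R ≥ 1` enters. -/
theorem pow_le_exp_mul_factorial_rpow {M R : ℝ} (hM : 0 ≤ M) (hR : 1 ≤ R) (n : ℕ) :
    M ^ n ≤ Real.exp M * (n ! : ℝ) ^ R := by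
  have h1 : M ^ n / n ! ≤ Real.exp M := Real.pow_div_factorial_le_exp M hM n
  have hn : (1 : ℝ) ≤ n ! := by exact_mod_cast n.factorial_pos
  rw [div_le_iff₀ (by linarith)] at h1
  refine h1.trans ?_
  gcongr
  exact Real.self_le_rpow_of_one_le hn hR

/-- The projective seminorm is an infimum over expressions of `x` as a sum of pure tensors, and the
triangle inequality gives the bound for each expression. -/
theorem norm_le_mul_piSeminorm {V E : Type*} [AddCommGroup V] [Module K V]
    [NormedAddCommGroup E] [NormedSpace K E]
    (p : Seminorm K V) {n : ℕ} (f : (⨂[K]^n V) →ₗ[K] E) {D : ℝ} (hD : 0 ≤ D)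
    (hf : ∀ v : Fin n → V, ‖f (PiTensorProduct.tprod K v)‖ ≤ D * ∏ i, p (v i)) (x : ⨂[K]^n V) :
    ‖f x‖ ≤ D * piSeminorm K p n x := by
  rw [piSeminorm_apply, Real.mul_iInf_of_nonneg hD]
  refine le_ciInf fun l => ?_
  have hx := (PiTensorProduct.mem_lifts_iff x l.1).1 l.2
  conv_lhs => rw [← hx]
  generalize (FreeAddMonoid.toList l.1) = L
  induction L with
  | nil => simp
  | cons a L ih =>
    simp only [List.map_cons, List.sum_cons, map_add, map_smul]
    refine (norm_add_le _ _).trans ?_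
    rw [mul_add, norm_smul]
    refine add_le_add ?_ ih
    calc _ ≤ ‖a.1‖ * (D * ∏ i, p (a.2 i)) := by gcongr; exact hf _
      _ = _ := by ring

theorem norm_le_tensorSeminorm {V E : Type*} [AddCommGroup V] [Module K V]
    [NormedAddCommGroup E] [NormedSpace K E] (p : Seminorm K V) (R : ℝ)
    (f : TensorAlgebra K V →ₗ[K] E)
    (hf : ∀ (n : ℕ) (v : Fin n → V),
      ‖f (TensorAlgebra.tprod K V n v)‖ ≤ (n ! : ℝ) ^ R * ∏ i, p (v i)) (x : TensorAlgebra K V) :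
    ‖f x‖ ≤ tensorSeminorm K R p x := by
  classical
  have hcomp : ∀ n, ‖f (TensorAlgebra.ofDirectSum
      (DirectSum.of (fun n => ⨂[K]^n V) n (tensorComponent K V n x)))‖ ≤
      (n ! : ℝ) ^ R * piSeminorm K p n (tensorComponent K V n x) := by
    intro n
    refine norm_le_mul_piSeminorm p (f ∘ₗ TensorAlgebra.ofDirectSum.toLinearMap ∘ₗ
      DirectSum.lof K ℕ (fun n => ⨂[K]^n V) n) (by positivity) (fun v => ?_) _
    have h : TensorAlgebra.ofDirectSum (DirectSum.lof K ℕ (fun n => ⨂[K]^n V) n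
        (PiTensorProduct.tprod K v)) = TensorAlgebra.tprod K V n v :=
      TensorAlgebra.ofDirectSum_of_tprod v
    simpa [h] using hf n v
  have hdec : x = ∑ n ∈ DFinsupp.support (TensorAlgebra.toDirectSum x),
      TensorAlgebra.ofDirectSum
        (DirectSum.of (fun n => ⨂[K]^n V) n (tensorComponent K V n x)) := by
    conv_lhs => rw [← TensorAlgebra.ofDirectSum_toDirectSum x,
      ← DirectSum.sum_support_of (TensorAlgebra.toDirectSum x), map_sum]
    rfl
  conv_lhs => rw [hdec, map_sum]
  refine (norm_sum_le _ _).trans ((Finset.sum_le_sum fun n _ => hcomp n).trans ?_)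
  exact (summable_tensorSeminorm R p x).sum_le_tsum _ fun n _ => by positivity

theorem continuous_of_norm_le_tensorSeminorm {V E : Type*} [AddCommGroup V] [Module K V]
    [TopologicalSpace V] [NormedAddCommGroup E] [NormedSpace K E] {p : Seminorm K V}
    (hp : Continuous p) (R : ℝ) (f : TensorAlgebra K V →ₗ[K] E)
    (hf : ∀ x, ‖f x‖ ≤ tensorSeminorm K R p x) :
    @Continuous _ _ (tensorTopology K V R) _ f := by
  refine continuous_iInf_dom (i := (⟨p, hp⟩ : {p : Seminorm K V // Continuous p})) ?_
  let := (tensorSeminorm K R p).toAddGroupSeminorm.toSeminormedAddCommGroup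
  exact AddMonoidHomClass.continuous_of_bound f 1 fun x => (hf x).trans_eq (one_mul _).symm

/-- `pbwMap` is a restriction of the algebra map from the tensor algebra, so it suffices to bound
`F` on words, with no symmetrization. -/
theorem continuous_envelopingSymTopology {g E : Type*} [LieRing g] [LieAlgebra K g]
    [TopologicalSpace g] [NormedAddCommGroup E] [NormedSpace K E] {p : Seminorm K g}
    (hp : Continuous p) (R : ℝ) (F : UniversalEnvelopingAlgebra K g →ₗ[K] E)
    (hF : ∀ (n : ℕ) (v : Fin n → g),
      ‖F (List.ofFn fun i => UniversalEnvelopingAlgebra.ι K (v i)).prod‖ ≤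
        (n ! : ℝ) ^ R * ∏ i, p (v i)) :
    @Continuous _ _ (envelopingSymTopology K g R) _ F := by
  refine continuous_coinduced_dom.2 ?_
  have h := continuous_of_norm_le_tensorSeminorm hp R
    (F ∘ₗ (TensorAlgebra.lift K
      (UniversalEnvelopingAlgebra.ι K (L := g) : g →ₗ[K] _)).toLinearMap)
    (norm_le_tensorSeminorm p R _ fun n v => by
      simpa [TensorAlgebra.tprod_apply, map_list_prod, List.map_ofFn, Function.comp_def]
        using hF n v)
  let := tensorTopology K g R
  exact h.comp continuous_induced_dom

end Functionals

/-! ### Coefficients of finite-dimensional representations -/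

section Coefficients

variable {K : Type*} [RCLike K] {g : Type*} [LieRing g] [LieAlgebra K g] [FiniteDimensional K g]

theorem exists_norm_coefficient_le {A : Type*} [Ring A] [Algebra K A] [FiniteDimensional K A]
    (θ : UniversalEnvelopingAlgebra K g →ₐ[K] A) (l : A →ₗ[K] K) {R : ℝ} (hR : 1 ≤ R) :
    ∃ c : ℝ, 0 < c ∧ ∀ (n : ℕ) (v : Fin n → g),
      c * ‖l (θ (List.ofFn fun i => UniversalEnvelopingAlgebra.ι K (v i)).prod)‖ ≤
        (n ! : ℝ) ^ R * ∏ i, coordSeminorm K g (v i) := by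
  obtain ⟨C, M, hC, hM, h⟩ := exists_norm_functional_prod_le
    (θ.toLinearMap ∘ₗ (UniversalEnvelopingAlgebra.ι K (L := g) : g →ₗ[K] _)) l
  -- `C + 1` replaces `C`, which may vanish, so that the rescaling constant is positive.
  have hpos : 0 < (C + 1) * Real.exp M := by positivity
  refine ⟨((C + 1) * Real.exp M)⁻¹, inv_pos.2 hpos, fun n v => ?_⟩
  rw [inv_mul_le_iff₀ hpos]
  have h' : ‖l (θ (List.ofFn fun i => UniversalEnvelopingAlgebra.ι K (v i)).prod)‖ ≤
      C * (M ^ n * ∏ i, coordSeminorm K g (v i)) := by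
    simpa [map_list_prod, List.map_ofFn, Function.comp_def] using h n v
  have hP : 0 ≤ ∏ i, coordSeminorm K g (v i) := Finset.prod_nonneg fun i _ => apply_nonneg _ _
  calc _ ≤ (C + 1) * (Real.exp M * (n ! : ℝ) ^ R * ∏ i, coordSeminorm K g (v i)) := by
        refine h'.trans ?_
        gcongr
        · linarith
        · exact pow_le_exp_mul_factorial_rpow hM hR n
    _ = _ := by ring

theorem continuous_coefficient [TopologicalSpace g] [IsTopologicalAddGroup g]
    [ContinuousSMul K g] [T2Space g] {A : Type*} [Ring A] [Algebra K A] [FiniteDimensional K A]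
    (θ : UniversalEnvelopingAlgebra K g →ₐ[K] A) (l : A →ₗ[K] K) {R : ℝ} (hR : 1 ≤ R) :
    @Continuous _ _ (envelopingSymTopology K g R) _ (fun u => l (θ u)) := by
  obtain ⟨c, hc, h⟩ := exists_norm_coefficient_le θ l hR
  have hc' : (c : K) ≠ 0 := by exact_mod_cast hc.ne'
  have h1 := continuous_envelopingSymTopology (K := K) continuous_coordSeminorm R
    ((c : K) • (l ∘ₗ θ.toLinearMap)) (fun n v => by
      rw [LinearMap.smul_apply, norm_smul, RCLike.norm_ofReal, abs_of_pos hc]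
      exact h n v)
  let := envelopingSymTopology K g R
  have h2 := h1.const_smul (c : K)⁻¹
  convert h2 using 2 with u
  exact (inv_smul_smul₀ hc' _).symm

end Coefficients

/-! ### Products of coefficients via tensor products of representations -/

section Convolution

attribute [local instance] LieRing.ofAssociativeRing

variable {K : Type*} [Field K] {g : Type*} [LieRing g] [LieAlgebra K g]

/-- The tensor product `θ ⊗ 1 + 1 ⊗ ψ` of two representations. -/
noncomputable def LieHom.tensorAdd {A B : Type*} [Ring A] [Algebra K A] [Ring B] [Algebra K B]
    (θ : g →ₗ⁅K⁆ A) (ψ : g →ₗ⁅K⁆ B) : g →ₗ⁅K⁆ A ⊗[K] B where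
  toLinearMap := (Algebra.TensorProduct.includeLeft (R := K) (S := K) (A := A) (B := B)).toLinearMap ∘ₗ
      (θ : g →ₗ[K] A) +
    (Algebra.TensorProduct.includeRight (R := K) (A := A) (B := B)).toLinearMap ∘ₗ (ψ : g →ₗ[K] B)
  map_lie' {x y} := by
    simp [Ring.lie_def, mul_add, add_mul, TensorProduct.sub_tmul, TensorProduct.tmul_sub]
    abel

theorem LieHom.tensorAdd_apply {A B : Type*} [Ring A] [Algebra K A] [Ring B] [Algebra K B]
    (θ : g →ₗ⁅K⁆ A) (ψ : g →ₗ⁅K⁆ B) (x : g) :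
    LieHom.tensorAdd θ ψ x = θ x ⊗ₜ[K] 1 + 1 ⊗ₜ[K] ψ x := rfl

/-- The summands commute, so the binomial theorem applies: the sequences `l (a ^ i)` and `m (b ^ i)`
multiply like exponential generating functions, and orders of vanishing add. -/
theorem tensor_functional_add_pow {A B : Type*} [Ring A] [Algebra K A] [Ring B] [Algebra K B]
    (l : A →ₗ[K] K) (m : B →ₗ[K] K) (a : A) (b : B) (n : ℕ) :
    (LinearMap.mul' K K ∘ₗ TensorProduct.map l m) ((a ⊗ₜ[K] (1 : B) + (1 : A) ⊗ₜ[K] b) ^ n) =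
      ∑ i ∈ Finset.range (n + 1), l (a ^ i) * m (b ^ (n - i)) * (n.choose i : K) := by
  have hc : Commute (a ⊗ₜ[K] (1 : B)) ((1 : A) ⊗ₜ[K] b) := by
    simp [Commute, SemiconjBy]
  rw [hc.add_pow, map_sum]
  refine Finset.sum_congr rfl fun i _ => ?_
  rw [← nsmul_eq_mul', map_nsmul]
  simp [Algebra.TensorProduct.tmul_pow, nsmul_eq_mul, mul_comm]

end Convolution


/-! ### Infinitely many independent coefficients -/

section Independence

attribute [local instance] LieRing.ofAssociativeRing

variable (K : Type u) [Field K] (g : Type v) [LieRing g] [LieAlgebra K g]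
  [FiniteDimensional K g] [Nontrivial g]

/-- Either the adjoint representation is nonzero, or `g` is abelian and any nonzero linear form acts
by scalars. -/
theorem exists_nonzero_representation :
    ∃ (ρ : g →ₗ⁅K⁆ Module.End K g) (x : g), ρ x ≠ 0 := by
  by_cases h : ∃ x : g, LieAlgebra.ad K g x ≠ 0
  · exact ⟨LieAlgebra.ad K g, h⟩
  · push Not at h
    obtain ⟨x, hx⟩ := exists_ne (0 : g)
    have hμx : ∃ μ : Module.Dual K g, μ x ≠ 0 := by
      by_contra! hcon
      exact hx ((Module.forall_dual_apply_eq_zero_iff K x).1 hcon)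
    obtain ⟨μ, hμ⟩ := hμx
    refine ⟨{ toLinearMap := μ.smulRight 1, map_lie' := ?_ }, x, ?_⟩
    · intro a b
      have hab : ⁅a, b⁆ = 0 := by
        simpa using LinearMap.congr_fun (h a) b
      simp [hab, Ring.lie_def, smul_smul, mul_comm]
    · intro h0
      have h1 : μ x • x = 0 := LinearMap.congr_fun h0 x
      exact (smul_ne_zero hμ hx) h1

variable [CharZero K]

/-- A coefficient of order exactly `1` along the powers of `x` is built first; multiplying by it
raises the order by one each time. -/
theorem exists_triangular_coefficients :
    ∃ x : g, ∀ k : ℕ, ∃ (A : Type max u v) (_ : Ring A) (_ : Algebra K A)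
      (_ : FiniteDimensional K A) (θ : g →ₗ⁅K⁆ A) (l : A →ₗ[K] K),
      (∀ j < k, l (θ x ^ j) = 0) ∧ l (θ x ^ k) ≠ 0 := by
  obtain ⟨ρ, x, hx⟩ := exists_nonzero_representation K g
  obtain ⟨m, hm⟩ : ∃ m : Module.Dual K (Module.End K g), m (ρ x) ≠ 0 := by
    by_contra! hcon
    exact hx ((Module.forall_dual_apply_eq_zero_iff K _).1 hcon)
  -- The trivial factor `K` allows the subtraction of `m 1`, so that `f` kills the unit `(1, 1)`
  -- without changing its value at `ψ x`.
  let ψ : g →ₗ⁅K⁆ K × Module.End K g :=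
    { toLinearMap := LinearMap.inr K K (Module.End K g) ∘ₗ (ρ : g →ₗ[K] Module.End K g)
      map_lie' := by
        intro a b
        ext <;> simp [Ring.lie_def] }
  have hψ : ψ x = (0, ρ x) := rfl
  let f : K × Module.End K g →ₗ[K] K :=
    m ∘ₗ LinearMap.snd K K _ - m 1 • LinearMap.fst K K _
  have hf0 : f (ψ x ^ 0) = 0 := by simp [f]
  have hf1 : f (ψ x ^ 1) ≠ 0 := by simpa [f, hψ] using hm
  refine ⟨x, fun k => ?_⟩
  induction k with
  | zero =>
    exact ⟨K × Module.End K g, inferInstance, inferInstance, inferInstance, ψ,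
      LinearMap.fst K K _, by simp, by simp⟩
  | succ k ih =>
    obtain ⟨A, _, _, _, θ, l, h0, h1⟩ := ih
    refine ⟨A ⊗[K] (K × Module.End K g), inferInstance, inferInstance, inferInstance,
      θ.tensorAdd ψ, LinearMap.mul' K K ∘ₗ TensorProduct.map l f, fun j hj => ?_, ?_⟩
    · rw [LieHom.tensorAdd_apply, tensor_functional_add_pow]
      refine Finset.sum_eq_zero fun i hi => ?_
      rw [Finset.mem_range] at hi
      rcases lt_or_ge i k with hik | hik
      · simp [h0 i hik]
      · have : j - i = 0 := by omega
        simp only [this, hf0, mul_zero, zero_mul]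
    -- Only `i = k` survives, with binomial coefficient `k + 1`, nonzero in characteristic zero.
    · rw [LieHom.tensorAdd_apply, tensor_functional_add_pow,
        Finset.sum_eq_single_of_mem k (by simp)]
      · rw [Nat.add_sub_cancel_left]
        refine mul_ne_zero (mul_ne_zero h1 hf1) ?_
        simp [Nat.cast_add_one_ne_zero]
      · intro i hi hik
        rw [Finset.mem_range] at hi
        rcases lt_or_gt_of_ne hik with hlt | hgt
        · simp [h0 i hlt]
        · have : k + 1 - i = 0 := by omega
          simp only [this, hf0, mul_zero, zero_mul]

end Independence

/-- In a relation with least nonzero index `k`, evaluation at `y k` leaves only the `k`-th term. -/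
theorem linearIndependent_of_triangular {K U : Type*} [Field K] [AddCommGroup U] [Module K U]
    (f : ℕ → U →ₗ[K] K) (y : ℕ → U) (h0 : ∀ k, ∀ j < k, f k (y j) = 0)
    (h1 : ∀ k, f k (y k) ≠ 0) : LinearIndependent K f := by
  rw [linearIndependent_iff']
  intro s c hc
  by_contra! hcon
  classical
  have hne : (s.filter fun i => c i ≠ 0).Nonempty := by
    obtain ⟨i, hi, hi'⟩ := hcon
    exact ⟨i, by simp [hi, hi']⟩
  obtain ⟨k, hk, hmin⟩ := Finset.exists_min_image _ id hne
  rw [Finset.mem_filter] at hk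
  have := LinearMap.congr_fun hc (y k)
  rw [LinearMap.sum_apply, Finset.sum_eq_single_of_mem k hk.1] at this
  · exact mul_ne_zero hk.2 (h1 k) this
  · intro i hi hik
    by_cases hci : c i = 0
    · simp [hci]
    · have hki : k ≤ i := hmin i (by simp [hi, hci])
      simp [h0 i k (lt_of_le_of_ne hki hik.symm)]

/-- A linear map into a normed space which is continuous for a weak topology takes values
controlled by finitely many of the defining functionals. -/
theorem exists_finite_iInf_ker_le_of_continuous_iInf_induced {K U E ι : Type*} [RCLike K]
    [AddCommGroup U] [Module K U] [NormedAddCommGroup E] [NormedSpace K E] (F : ι → U →ₗ[K] K)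
    (Φ : U →ₗ[K] E)
    (hΦ : @Continuous _ _ (⨅ i, TopologicalSpace.induced (F i) inferInstance) _ Φ) :
    ∃ I : Set ι, I.Finite ∧ ∀ u, (∀ i ∈ I, F i u = 0) → Φ u = 0 := by
  have hmem : Φ ⁻¹' Metric.ball 0 1 ∈
      @nhds U (⨅ i, TopologicalSpace.induced (F i) inferInstance) 0 := by
    let : TopologicalSpace U := ⨅ i, TopologicalSpace.induced (F i) inferInstance
    refine hΦ.continuousAt.preimage_mem_nhds ?_
    rw [map_zero]
    exact Metric.ball_mem_nhds _ one_pos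
  rw [nhds_iInf, Filter.mem_iInf] at hmem
  obtain ⟨I, hI, V, hV, hW⟩ := hmem
  refine ⟨I, hI, fun u hu => ?_⟩
  -- A basic neighbourhood of `0` contains the whole line through `u`, on which `Φ` is therefore
  -- bounded.
  have hsub : ∀ c : K, ‖Φ (c • u)‖ < 1 := by
    intro c
    have hcu : c • u ∈ ⋂ i, V i := by
      refine Set.mem_iInter.2 fun i => ?_
      have := hV i
      rw [nhds_induced, Filter.mem_comap] at this
      obtain ⟨t, ht, hts⟩ := this
      apply hts
      have h0 : (0 : K) ∈ t := by simpa using mem_of_mem_nhds ht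
      simpa [hu i i.2] using h0
    rw [← hW] at hcu
    simpa using hcu
  by_contra hne
  have hpos : ‖Φ u‖ ≠ 0 := by simpa using hne
  have := hsub ((‖Φ u‖⁻¹ : ℝ) : K)
  rw [map_smul, norm_smul] at this
  simp [hpos] at this

theorem continuous_moduleTopology_of_functionals {K X W : Type*} [RCLike K] [TopologicalSpace X]
    [AddCommGroup W] [Module K W] [FiniteDimensional K W] (G : X → W)
    (h : ∀ l : W →ₗ[K] K, Continuous fun x => l (G x)) :
    @Continuous _ _ _ (moduleTopology K W) G := by
  let : TopologicalSpace W := moduleTopology K W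
  have : IsModuleTopology K W := ⟨rfl⟩
  have : ContinuousAdd W := IsModuleTopology.toContinuousAdd K W
  let b := Module.finBasis K W
  have h1 : Continuous (b.equivFun.symm.toLinearMap : (Fin (Module.finrank K W) → K) →ₗ[K] W) :=
    IsModuleTopology.continuous_of_linearMap _
  have h2 : Continuous fun x => b.equivFun (G x) :=
    continuous_pi fun i => h (b.coord i)
  convert h1.comp h2 using 1
  ext x
  simp

/-! ### The coarsest topology and strictness -/

section Main

variable (K : Type u) [RCLike K] (g : Type v) [LieRing g] [LieAlgebra K g]

/-- The coefficients of the finite-dimensional representations of `g`. -/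
def representationCoefficients : Set (UniversalEnvelopingAlgebra K g →ₗ[K] K) :=
  {F | ∃ (V : Type w) (_ : AddCommGroup V) (_ : Module K V) (_ : FiniteDimensional K V)
    (_ : LieRingModule g V) (_ : LieModule K g V) (l : Module.End K V →ₗ[K] K),
    F = l ∘ₗ (UniversalEnvelopingAlgebra.lift K (LieModule.toEnd K g V)).toLinearMap}

/-- The weak topology of the coefficients of the finite-dimensional representations. -/
@[reducible] def coefficientTopology : TopologicalSpace (UniversalEnvelopingAlgebra K g) :=
  ⨅ F : representationCoefficients.{u, v, w} K g,
    TopologicalSpace.induced F.1 inferInstance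

theorem isGreatest_coefficientTopology :
    IsGreatest {t : TopologicalSpace (UniversalEnvelopingAlgebra K g) |
        IsLocallyConvexTopology K (UniversalEnvelopingAlgebra K g) t ∧
          FiniteDimRepsContinuous.{u, v, w} K g t} (coefficientTopology.{u, v, w} K g) := by
  refine ⟨⟨PolynormableSpace.iInf fun F => PolynormableSpace.induced F.1, ?_⟩, ?_⟩
  · intro V _ _ _ _ _
    let := coefficientTopology.{u, v, w} K g
    refine continuous_moduleTopology_of_functionals _ fun l => ?_
    exact continuous_iInf_dom (i := (⟨_, V, _, _, ‹_›, _, ‹_›, l, rfl⟩ :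
      representationCoefficients.{u, v, w} K g)) continuous_induced_dom
  · rintro t ⟨-, ht⟩
    refine le_iInf fun F => continuous_iff_le_induced.1 ?_
    obtain ⟨F, V, _, _, _, _, _, l, rfl⟩ := F
    have h := ht V
    let : TopologicalSpace (Module.End K V) := moduleTopology K (Module.End K V)
    have : IsModuleTopology K (Module.End K V) := ⟨rfl⟩
    have hl : Continuous l := IsModuleTopology.continuous_of_linearMap l
    exact hl.comp h

variable [FiniteDimensional K g] [TopologicalSpace g] [IsTopologicalAddGroup g]
  [ContinuousSMul K g] [T2Space g] {R : ℝ}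

theorem envelopingSymTopology_le_coefficientTopology (hR : 1 ≤ R) :
    envelopingSymTopology K g R ≤ coefficientTopology.{u, v, w} K g := by
  refine le_iInf fun F => continuous_iff_le_induced.1 ?_
  obtain ⟨F, V, _, _, _, _, _, l, rfl⟩ := F
  exact continuous_coefficient
    (UniversalEnvelopingAlgebra.lift K (LieModule.toEnd K g V)) l hR

/-- Only independence and a common `p_R` bound are needed; the `f k` need not come from
representations in the universe `w` that defines `τ`. -/
theorem exists_continuous_map_of_independent_coefficients [Nontrivial g] (hR : 1 ≤ R) :
    ∃ f : ℕ → UniversalEnvelopingAlgebra K g →ₗ[K] K, LinearIndependent K f ∧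
      ∃ Φ : UniversalEnvelopingAlgebra K g →ₗ[K] lp (fun _ : ℕ => K) ⊤,
        @Continuous _ _ (envelopingSymTopology K g R) _ Φ ∧
          ∀ u, Φ u = 0 → ∀ k, f k u = 0 := by
  obtain ⟨x, hx⟩ := exists_triangular_coefficients K g
  choose A iR iA iF θ l h0 h1 using hx
  let ψ k := UniversalEnvelopingAlgebra.lift K (θ k)
  choose c hc hcb using fun k => exists_norm_coefficient_le (ψ k) (l k) hR
  let f : ℕ → UniversalEnvelopingAlgebra K g →ₗ[K] K := fun k => l k ∘ₗ (ψ k).toLinearMap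
  have hfx : ∀ k j, f k (UniversalEnvelopingAlgebra.ι K x ^ j) = l k (θ k x ^ j) := by
    intro k j
    simp [f, ψ]
  have hind : LinearIndependent K f :=
    linearIndependent_of_triangular f (fun j => UniversalEnvelopingAlgebra.ι K x ^ j)
      (fun k j hj => by rw [hfx]; exact h0 k j hj) (fun k => by rw [hfx]; exact h1 k)
  let T := TensorAlgebra.lift K
    (UniversalEnvelopingAlgebra.ι K (L := g) : g →ₗ[K] UniversalEnvelopingAlgebra K g)
  -- Any tensor `t` over `u` bounds all `c k * f k u` by its seminorm, which places the sequence in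
  -- `ℓ^∞`.
  have hT : Function.Surjective T := by
    have h : T = UniversalEnvelopingAlgebra.mkAlgHom K g := by
      ext y
      simp [T]
    rw [h]
    exact RingCon.mkₐ_surjective (UniversalEnvelopingAlgebra.ringCon K g)
  have hnorm : ∀ k u, ‖(c k : K) * f k u‖ = c k * ‖f k u‖ := fun k u => by
    simp [abs_of_pos (hc k)]
  have hbound : ∀ t k, ‖(c k : K) * f k (T t)‖ ≤ tensorSeminorm K R (coordSeminorm K g) t := by
    intro t k
    refine norm_le_tensorSeminorm (coordSeminorm K g) R
      ((c k : K) • (f k ∘ₗ T.toLinearMap)) (fun n v => ?_) t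
    have hv : T (TensorAlgebra.tprod K g n v) =
        (List.ofFn fun i => UniversalEnvelopingAlgebra.ι K (v i)).prod := by
      simp [T, TensorAlgebra.tprod_apply, map_list_prod, List.map_ofFn, Function.comp_def]
    refine (hnorm k _).trans_le ?_
    rw [AlgHom.toLinearMap_apply, hv]
    exact hcb k n v
  have hmem : ∀ u, Memℓp (fun k => (c k : K) * f k u) ⊤ := by
    intro u
    obtain ⟨t, rfl⟩ := hT u
    refine memℓp_infty ⟨tensorSeminorm K R (coordSeminorm K g) t, ?_⟩
    rintro _ ⟨k, rfl⟩
    exact hbound t k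
  let Φ : UniversalEnvelopingAlgebra K g →ₗ[K] lp (fun _ : ℕ => K) ⊤ :=
    { toFun := fun u => ⟨fun k => (c k : K) * f k u, hmem u⟩
      map_add' := fun u v => Subtype.ext <| funext fun k => by
        simp only [map_add, mul_add]
        rfl
      map_smul' := fun a u => Subtype.ext <| funext fun k => by
        simp only [map_smul, smul_eq_mul, mul_left_comm]
        rfl }
  refine ⟨f, hind, Φ, ?_, fun u hu k => ?_⟩
  · refine continuous_envelopingSymTopology continuous_coordSeminorm R Φ fun n v => ?_
    refine lp.norm_le_of_forall_le (mul_nonneg (by positivity)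
      (Finset.prod_nonneg fun i _ => apply_nonneg _ _)) fun k => ?_
    exact (hnorm k _).trans_le (hcb k n v)
  · have h : (c k : K) * f k u = 0 := congrFun (congrArg Subtype.val hu) k
    have hck : (c k : K) ≠ 0 := by exact_mod_cast (hc k).ne'
    exact (mul_eq_zero.1 h).resolve_left hck

theorem envelopingSymTopology_ne_coefficientTopology [Nontrivial g] (hR : 1 ≤ R) :
    envelopingSymTopology K g R ≠ coefficientTopology.{u, v, w} K g := by
  intro heq
  obtain ⟨f, hf, Φ, hΦ, hker⟩ := exists_continuous_map_of_independent_coefficients K g hR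
  rw [heq] at hΦ
  obtain ⟨I, hI, hIΦ⟩ := exists_finite_iInf_ker_le_of_continuous_iInf_induced _ Φ hΦ
  have := hI.to_subtype
  let L : I → UniversalEnvelopingAlgebra K g →ₗ[K] K := fun i => i.1.1
  -- A functional vanishing on the common kernel of finitely many functionals is a linear
  -- combination of them.
  have hspan : ∀ k, f k ∈ Submodule.span K (Set.range L) := fun k => by
    refine mem_span_of_iInf_ker_le_ker fun u hu => ?_
    rw [Submodule.mem_iInf] at hu
    exact hker u (hIΦ u fun i hi => hu ⟨i, hi⟩) k
  have : FiniteDimensional K (Submodule.span K (Set.range L)) :=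
    FiniteDimensional.span_of_finite K (Set.finite_range L)
  have hf' : LinearIndependent K
      fun k => (⟨f k, hspan k⟩ : Submodule.span K (Set.range L)) :=
    LinearIndependent.of_comp (Submodule.subtype _) hf
  exact Infinite.not_finite hf'.finite

end Main

theorem mainTheorem10 (K : Type u) [RCLike K]
    (g : Type v) [LieRing g] [LieAlgebra K g] [FiniteDimensional K g] [Nontrivial g]
    [TopologicalSpace g] [IsTopologicalAddGroup g] [ContinuousSMul K g] [T2Space g]
    (R : ℝ) (hR : 1 ≤ R) :
    ∃ τ : TopologicalSpace (UniversalEnvelopingAlgebra K g),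
      IsGreatest {t : TopologicalSpace (UniversalEnvelopingAlgebra K g) |
        IsLocallyConvexTopology K (UniversalEnvelopingAlgebra K g) t ∧
          FiniteDimRepsContinuous.{u, v, w} K g t} τ ∧
      envelopingSymTopology K g R < τ :=
  ⟨coefficientTopology.{u, v, w} K g, isGreatest_coefficientTopology K g,
    lt_of_le_of_ne (envelopingSymTopology_le_coefficientTopology K g hR)
      (envelopingSymTopology_ne_coefficientTopology K g hR)⟩
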